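/- **Theorem (Walks ending on the diagonal).** For integers $i,j,n\ge 0$ let $a_{i,j}(n)$ be the number of $n$-step lattice walks from $(0,0)$ to $(i,j)$ whose steps are South $(0,-1)$, West $(-1,0)$ or North-East $(1,1)$ and which always stay in the quadrant $\{(u,v)\in\mathbb{Z}^2 : u\ge 0,\ v\ge 0\}$ (Kreweras walks). Let $$Q_d(x;t)=\sum_{i,n\ge 0} a_{i,i}(n)\,x^i t^n$$ be the generating function of the Kreweras walks ending on the diagonal. There is a unique power series $W\equiv W(t)\in\mathbb{Q}[[t]]$ satisfying $$W=t\,(2+W^3),$$ and, in the ring $\mathbb{Q}[x,x^{-1}][[t]]$ of power series in $t$ whose coefficients are Laurent polynomials in $x$, $$t\,Q_d(x;t)=\frac{W-\frac1x}{\sqrt{1-xW\left(1+\frac{W^3}{4}\right)+\frac{x^2W^2}{4}}}+\frac1x ,$$ where the square root denotes the unique square root in $\mathbb{Q}[x,x^{-1}][[t]]$ whose constant term in $t$ is $1$ (it exists and is invertible). -/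

import Mathlib

open scoped LaurentPolynomial PowerSeries

/-- The three allowed steps: South, West and North-East. -/
def krewerasSteps : Finset (ℤ × ℤ) := {(0, -1), (-1, 0), (1, 1)}

/-- The position, after the first `m` steps, of the walk that starts from `(0, 0)` and
has step sequence `s`. -/
def walkPosition {n : ℕ} (s : Fin n → ℤ × ℤ) (m : ℕ) : ℤ × ℤ :=
  ∑ k : Fin n with k.val < m, s k

/-- The `n`-step walks from `(0, 0)` to `(i, j)`, given by their step sequences, with steps
South, West and North-East, that stay in the first quadrant. -/
def krewerasWalks (i j n : ℕ) : Finset (Fin n → ℤ × ℤ) :=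
  {s ∈ Fintype.piFinset fun _ : Fin n => krewerasSteps |
    (∀ m ≤ n, 0 ≤ (walkPosition s m).1 ∧ 0 ≤ (walkPosition s m).2) ∧
      walkPosition s n = ((i : ℤ), (j : ℤ))}

/-- The number `a_{i,j}(n)` of `n`-step Kreweras walks ending at `(i, j)`. -/
def krewerasCount (i j n : ℕ) : ℕ := (krewerasWalks i j n).card

/-- An `n`-step walk cannot end at an abscissa larger than `n`; hence the finite sum over
`i ≤ n` in `krewerasDiagonal` is the sum over all `i ≥ 0`. -/
theorem krewerasCount_eq_zero_of_lt {i j n : ℕ} (h : n < i) : krewerasCount i j n = 0 := by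
  rw [krewerasCount, Finset.card_eq_zero, krewerasWalks, Finset.filter_eq_empty_iff]
  rintro s hs ⟨-, he⟩
  rw [Fintype.mem_piFinset] at hs
  have h1 : (walkPosition s n).1 = (i : ℤ) := by rw [he]
  have h2 : (walkPosition s n).1 ≤ n := by
    rw [walkPosition, Finset.filter_true_of_mem (fun k _ => k.2), Prod.fst_sum]
    calc ∑ k, (s k).1 ≤ ∑ _k : Fin n, (1 : ℤ) := by
          refine Finset.sum_le_sum fun k _ => ?_
          have hk := hs k
          simp only [krewerasSteps, Finset.mem_insert, Finset.mem_singleton] at hk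
          rcases hk with hk | hk | hk <;> simp [hk]
      _ = n := by simp
  omega

/-- The generating function `Q_d(x;t) = ∑_{i,n ≥ 0} a_{i,i}(n) x^i t^n` of Kreweras walks ending
on the diagonal, as a power series in `t` (the variable `PowerSeries.X`) whose coefficients are
Laurent polynomials in `x` (the variable `LaurentPolynomial.T 1`). -/
noncomputable def krewerasDiagonal : ℚ[T;T⁻¹]⟦X⟧ :=
  PowerSeries.mk fun n =>
    ∑ i ∈ Finset.range (n + 1), (krewerasCount i i n : ℚ[T;T⁻¹]) * LaurentPolynomial.T (i : ℤ)

/-- The Laurent monomial `x^k`, as a power series in `t` that is constant in `t`. -/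
noncomputable def xPow (k : ℤ) : ℚ[T;T⁻¹]⟦X⟧ :=
  PowerSeries.C (LaurentPolynomial.T k)

/-- A power series in `t` with rational coefficients, seen as a power series in `t` whose
coefficients are (constant) Laurent polynomials in `x`. -/
noncomputable def liftSeries (F : ℚ⟦X⟧) : ℚ[T;T⁻¹]⟦X⟧ :=
  PowerSeries.map (algebraMap ℚ ℚ[T;T⁻¹]) F

/-- The series `1 - x W (1 + W³/4) + x² W²/4`. -/
noncomputable def diagonalRadicand (W : ℚ⟦X⟧) : ℚ[T;T⁻¹]⟦X⟧ :=
  1 - xPow 1 * liftSeries (W * (1 + PowerSeries.C (1 / 4) * W ^ 3))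
    + xPow 2 * liftSeries (PowerSeries.C (1 / 4) * W ^ 2)

/-! The proof combines the kernel method with an invariant. Let `R` be the series of walks ending on
the x-axis (`axisSeries`). If series `u, v` satisfy `uv = t(u + v + u²v²)`, the quadrant functional
equation collapses to `t u R(u) + t v R(v) = uv`, and then `I(u) = t²u²R(u)² - uR(u) + 2tR(u) + u`
satisfies `I(u) = I(v)` (`krewerasInvariant_eq`). Pairing `x` with the kernel root that has no
constant term in `t` shows that `I` does not depend on `x`. The double point `u = v = W` gives its
value in terms of `W` (`exists_krewerasInvariant_eq`).

Cutting the quadrant along the diagonal gives a second functional equation, for walks ending in `j ≤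
i`. Cancelling its kernel relates `Q_d` linearly to `R(u)` at a series `u`
(`diagonal_kernel_equation`). The quadratic equation `I(u) = κ` then makes `Q_d` a quotient of
square roots, which simplifies through `W = t(2 + W³)`; constant terms fix the sign. -/

namespace PowerSeries

/-! ### Fixed points, square roots and substitutions in power series. -/

variable {B : Type*} [CommRing B]

/-- Fixed points of contractions of the form `y ↦ c + X * P(y)`. -/
theorem exists_eq_add_X_mul_eval (c : B⟦X⟧) (P : Polynomial B⟦X⟧) :
    ∃ y : B⟦X⟧, y = c + X * P.eval y := by
  set Φ : B⟦X⟧ → B⟦X⟧ := fun y => c + X * P.eval y with hΦ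
  have contr : ∀ (n : ℕ) (a b : B⟦X⟧), (X : B⟦X⟧) ^ n ∣ a - b → (X : B⟦X⟧) ^ (n + 1) ∣ Φ a - Φ b := by
    intro n a b h
    have h2 : Φ a - Φ b = X * (P.eval a - P.eval b) := by simp only [hΦ]; ring
    rw [h2, pow_succ']
    exact mul_dvd_mul_left _ (h.trans (Polynomial.sub_dvd_eval_sub a b P))
  have step : ∀ n : ℕ, (X : B⟦X⟧) ^ n ∣ Φ^[n + 1] 0 - Φ^[n] 0 := by
    intro n
    induction n with
    | zero => simp
    | succ n ih =>
      rw [Function.iterate_succ_apply' Φ (n + 1), Function.iterate_succ_apply' Φ n]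
      rw [Function.iterate_succ_apply' Φ n] at ih
      exact contr _ _ _ ih
  have stable : ∀ m n : ℕ, m + 1 ≤ n → coeff m (Φ^[n] 0) = coeff m (Φ^[m + 1] 0) := by
    intro m n h
    induction n, h using Nat.le_induction with
    | base => rfl
    | succ n hn ih =>
      rw [← ih, ← sub_eq_zero, ← map_sub]
      exact X_pow_dvd_iff.mp (step n) m (by omega)
  -- By `stable`, the coefficient of degree `n` no longer changes from iterate `n + 1` on.
  set y : B⟦X⟧ := mk fun n => coeff n (Φ^[n + 1] 0) with hy
  have approx : ∀ n : ℕ, (X : B⟦X⟧) ^ n ∣ y - Φ^[n] 0 := by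
    intro n
    rw [X_pow_dvd_iff]
    intro m hm
    rw [map_sub, hy, coeff_mk, stable m n hm, sub_self]
  refine ⟨y, ?_⟩
  ext n
  have h1 := approx (n + 1)
  have h2 := contr n _ _ (approx n)
  rw [← Function.iterate_succ_apply' Φ n] at h2
  have h3 := dvd_sub h1 h2
  rw [sub_sub_sub_cancel_right] at h3
  have h4 := X_pow_dvd_iff.mp h3 n (Nat.lt_succ_self n)
  rwa [map_sub, sub_eq_zero] at h4

/-- The substitution `s ↦ t` from power series in `s` over `B⟦t⟧` to `B⟦t⟧`. -/
noncomputable def diag : B⟦X⟧⟦X⟧ →+* B⟦X⟧ where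
  toFun F := mk fun m => ∑ p ∈ Finset.HasAntidiagonal.antidiagonal m, coeff p.1 (coeff p.2 F)
  map_zero' := by ext; simp
  map_add' F G := by ext; simp [Finset.sum_add_distrib]
  map_one' := by
    ext m
    rw [coeff_mk, coeff_one, Finset.sum_eq_single (m, 0)]
    · simp [coeff_one]
    · rintro ⟨a, b⟩ h hne
      rw [Finset.HasAntidiagonal.mem_antidiagonal] at h
      have : b ≠ 0 := by rintro rfl; exact hne (by simp_all)
      simp [coeff_one, this]
    · simp
  map_mul' F G := by
    ext m
    simp only [coeff_mk, coeff_mul, map_sum, Finset.sum_mul_sum, Finset.sum_sigma']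
    refine Finset.sum_nbij'
      (fun p => ⟨(p.2.2.1 + p.2.1.1, p.2.2.2 + p.2.1.2), (p.2.2.1, p.2.1.1), (p.2.2.2, p.2.1.2)⟩)
      (fun p => ⟨(p.2.1.1 + p.2.2.1, p.2.1.2 + p.2.2.2), (p.2.1.2, p.2.2.2), (p.2.1.1, p.2.2.1)⟩)
      ?_ ?_ ?_ ?_ ?_
    all_goals
      rintro ⟨⟨a, b⟩, ⟨c, d⟩, ⟨e, f⟩⟩ h
      simp only [Finset.mem_sigma, Finset.HasAntidiagonal.mem_antidiagonal] at h
      obtain ⟨h1, h2, h3⟩ := h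
      subst h2 h3
    · simp; omega
    · simp; omega
    · rfl
    · rfl
    · rfl

theorem coeff_diag (F : B⟦X⟧⟦X⟧) (m : ℕ) :
    coeff m (diag F) = ∑ p ∈ Finset.HasAntidiagonal.antidiagonal m, coeff p.1 (coeff p.2 F) := by
  change coeff m (mk fun m => ∑ p ∈ Finset.HasAntidiagonal.antidiagonal m,
    coeff p.1 (coeff p.2 F)) = _
  rw [coeff_mk]

@[simp]
theorem diag_C (a : B⟦X⟧) : diag (C a) = a := by
  ext m
  rw [coeff_diag, Finset.sum_eq_single (m, 0)]
  · simp
  · rintro ⟨a, b⟩ h hne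
    rw [Finset.HasAntidiagonal.mem_antidiagonal] at h
    have : b ≠ 0 := by rintro rfl; exact hne (by simp_all)
    simp [coeff_C, this]
  · simp

@[simp]
theorem diag_X : diag (X : B⟦X⟧⟦X⟧) = X := by
  ext m
  rw [coeff_diag, coeff_X]
  split_ifs with h
  · subst h
    rw [Finset.sum_eq_single (0, 1)]
    · simp
    · rintro ⟨a, b⟩ h hne
      rw [Finset.HasAntidiagonal.mem_antidiagonal] at h
      have : b ≠ 1 := by rintro rfl; exact hne (by simp at h; simp [h])
      simp [coeff_X, this]
    · simp
  · refine Finset.sum_eq_zero ?_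
    rintro ⟨a, b⟩ h'
    rw [Finset.HasAntidiagonal.mem_antidiagonal] at h'
    rw [coeff_X]
    split_ifs with hb
    · rw [coeff_one, if_neg]
      simp at h' hb
      omega
    · simp

theorem diag_map_C (F : B⟦X⟧) : diag (map C F) = F := by
  ext m
  rw [coeff_diag, Finset.sum_eq_single (0, m)]
  · simp
  · rintro ⟨a, b⟩ h hne
    rw [Finset.HasAntidiagonal.mem_antidiagonal] at h
    have : a ≠ 0 := by rintro rfl; exact hne (by simp_all)
    simp [coeff_C, this]
  · simp

theorem diag_mk_eq (c : ℕ → B⟦X⟧) :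
    diag (mk c) = c 0 + X * diag (mk fun n => c (n + 1)) := by
  have h : mk c = C (c 0) + X * mk fun n => c (n + 1) := by
    ext1 n
    cases n <;> simp [coeff_succ_X_mul]
  rw [h, map_add, map_mul, diag_C, diag_X]

/-- Two square roots with the same nonzero constant term agree. -/
theorem eq_of_sq_eq_sq_of_constantCoeff [IsDomain B] [CharZero B] {F G : B⟦X⟧} (h : F ^ 2 = G ^ 2)
    (h0 : constantCoeff F = constantCoeff G) (h1 : constantCoeff F ≠ 0) : F = G := by
  rcases sq_eq_sq_iff_eq_or_eq_neg.mp h with h | h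
  · exact h
  · rw [h, map_neg, neg_eq_iff_add_eq_zero, ← two_mul] at h0
    refine absurd ?_ h1
    rw [h, map_neg, (mul_eq_zero.mp h0).resolve_left two_ne_zero, neg_zero]

theorem exists_sq_eq_one_add_X_mul [Algebra ℚ B] (r : B⟦X⟧) :
    ∃ s : B⟦X⟧, constantCoeff s = 1 ∧ s ^ 2 = 1 + X * r := by
  set h : B⟦X⟧ := C (algebraMap ℚ B (1 / 2)) with hh
  have h2 : 2 * h = 1 := by
    rw [hh, ← map_ofNat (C (R := B)) 2, ← map_ofNat (algebraMap ℚ B) 2, ← map_mul, ← map_mul]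
    norm_num
  -- Expanding `(1 + ty)² = 1 + tr` gives the fixed-point equation `y = r/2 - t y²/2`.
  obtain ⟨y, hy⟩ := exists_eq_add_X_mul_eval (h * r) (-Polynomial.C h * Polynomial.X ^ 2)
  simp only [Polynomial.eval_mul, Polynomial.eval_neg, Polynomial.eval_C, Polynomial.eval_pow,
    Polynomial.eval_X] at hy
  refine ⟨1 + X * y, by simp, ?_⟩
  linear_combination 2 * X * hy + (X * r - X ^ 2 * y ^ 2) * h2

/-- The substitution `x ↦ u` from `ℚ[x]⟦t⟧` to `B⟦t⟧`. -/
noncomputable def substCoeff [Algebra ℚ B] (u : B⟦X⟧) : (Polynomial ℚ)⟦X⟧ →+* B⟦X⟧ :=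
  diag.comp (map (Polynomial.aeval u).toRingHom)

variable [Algebra ℚ B]

@[simp]
theorem substCoeff_X (u : B⟦X⟧) : substCoeff u X = X := by simp [substCoeff]

@[simp]
theorem substCoeff_C_X (u : B⟦X⟧) : substCoeff u (C Polynomial.X) = u := by simp [substCoeff]

theorem substCoeff_map_C (u : B⟦X⟧) (F : ℚ⟦X⟧) :
    substCoeff u (map Polynomial.C F) = map (algebraMap ℚ B) F := by
  rw [← diag_map_C (map (algebraMap ℚ B) F), substCoeff, RingHom.comp_apply]
  congr 1
  ext1 n
  rw [coeff_map, coeff_map, coeff_map, coeff_map]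
  exact (Polynomial.aeval_C u _).trans (algebraMap_apply ..)

theorem coeff_substCoeff (u : B⟦X⟧) (F : (Polynomial ℚ)⟦X⟧) (m : ℕ) :
    coeff m (substCoeff u F) =
      ∑ p ∈ Finset.HasAntidiagonal.antidiagonal m, coeff p.1 (Polynomial.aeval u (coeff p.2 F)) := by
  simp [substCoeff, coeff_diag]

/-- A series in `ℚ[x]⟦t⟧` that vanishes at `x = 0` and takes the same value at `x` and at a
series `y` without constant term is zero. -/
theorem eq_zero_of_substCoeff_eq {a : B} (ha : Function.Injective (Polynomial.aeval (R := ℚ) a))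
    {y : B⟦X⟧} (hy : constantCoeff y = 0) {D : (Polynomial ℚ)⟦X⟧}
    (hD : map (Polynomial.evalRingHom 0) D = 0) (h : substCoeff (C a) D = substCoeff y D) :
    D = 0 := by
  ext1 n
  rw [map_zero]
  induction n using Nat.strong_induction_on with
  | _ n ih =>
  -- Once the lower coefficients of `D` vanish, the `t^n` coefficient of `D(u)` sees only the
  -- constant term of `u`. The hypothesis then reads `D_n(a) = D_n(0) = 0`.
  have key : ∀ u : B⟦X⟧, coeff n (substCoeff u D) =
      Polynomial.aeval (constantCoeff u) (coeff n D) := by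
    intro u
    rw [coeff_substCoeff, Finset.sum_eq_single (0, n)]
    · have := Polynomial.hom_eval₂ (coeff n D) (algebraMap ℚ B⟦X⟧) constantCoeff u
      rw [Polynomial.aeval_def, Polynomial.aeval_def, coeff_zero_eq_constantCoeff_apply, this]
      congr 1
    · rintro ⟨p, q⟩ hp hne
      rw [Finset.HasAntidiagonal.mem_antidiagonal] at hp
      have : q ≠ n := by rintro rfl; exact hne (by simp_all)
      simp only at hp ⊢
      rw [ih q (by omega), map_zero, map_zero]
    · simp
  have h1 := congrArg (coeff n) h
  rw [key, key, hy, constantCoeff_C] at h1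
  apply ha
  rw [h1, map_zero]
  have h2 := congrArg (coeff n) hD
  rw [coeff_map, map_zero, Polynomial.coe_evalRingHom] at h2
  have h3 := Polynomial.aeval_algebraMap_apply B (0 : ℚ) (coeff n D)
  rw [map_zero] at h3
  rw [h3, Polynomial.coe_aeval_eq_eval, h2, map_zero]

end PowerSeries

/-! ### Walks summed by their end position, through a last-step recursion. -/

section Transfer

variable {M N : Type*} [AddCommMonoid M] [AddCommMonoid N]

/-- The sum of `φ` over the positions in the quadrant that are one step away from `(i, j)`. -/
def stepSum (φ : ℕ → ℕ → M) (i j : ℕ) : M :=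
  φ (i + 1) (j + 1) + (if 1 ≤ i then φ (i - 1) j else 0) + if 1 ≤ j then φ i (j - 1) else 0

/-- The sum of `φ` over the end positions of all `n`-step Kreweras walks. -/
def walkSum : ℕ → (ℕ → ℕ → M) → M
  | 0, φ => φ 0 0
  | n + 1, φ => walkSum n (stepSum φ)

theorem walkSum_map (f : M →+ N) (n : ℕ) (φ : ℕ → ℕ → M) :
    f (walkSum n φ) = walkSum n fun i j => f (φ i j) := by
  induction n generalizing φ with
  | zero => rfl
  | succ n ih =>
    rw [walkSum, walkSum, ih]
    congr 1
    funext i j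
    simp only [stepSum, map_add, apply_ite f, map_zero]

theorem walkSum_add (n : ℕ) (φ ψ : ℕ → ℕ → M) :
    (walkSum n fun i j => φ i j + ψ i j) = walkSum n φ + walkSum n ψ := by
  induction n generalizing φ ψ with
  | zero => rfl
  | succ n ih =>
    rw [walkSum, walkSum, walkSum, ← ih]
    congr 1
    funext i j
    simp only [stepSum]
    split_ifs <;> simp [add_assoc, add_left_comm]

theorem walkSum_swap (n : ℕ) (φ : ℕ → ℕ → M) :
    (walkSum n fun i j => φ j i) = walkSum n φ := by
  induction n generalizing φ with
  | zero => rfl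
  | succ n ih =>
    rw [walkSum, walkSum, ← ih]
    congr 1
    funext i j
    simp only [stepSum]
    abel

theorem walkSum_mul {B : Type*} [CommRing B] (n : ℕ) (a : B) (φ : ℕ → ℕ → B) :
    (walkSum n fun i j => a * φ i j) = a * walkSum n φ :=
  (walkSum_map (AddMonoidHom.mulLeft a) n φ).symm

theorem walkSum_sub {B : Type*} [CommRing B] (n : ℕ) (φ ψ : ℕ → ℕ → B) :
    (walkSum n fun i j => φ i j - ψ i j) = walkSum n φ - walkSum n ψ := by
  rw [eq_sub_iff_add_eq, ← walkSum_add]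
  simp

/-- The position `p` lies in the quadrant. -/
def InQuadrant (p : ℤ × ℤ) : Prop := 0 ≤ p.1 ∧ 0 ≤ p.2

instance : DecidablePred InQuadrant := fun _ => inferInstanceAs (Decidable (_ ∧ _))

/-- The `n`-step Kreweras walks with arbitrary end position. -/
def quadrantWalks (n : ℕ) : Finset (Fin n → ℤ × ℤ) :=
  {s ∈ Fintype.piFinset fun _ : Fin n => krewerasSteps | ∀ m ≤ n, InQuadrant (walkPosition s m)}

theorem walkPosition_snoc_of_le {n : ℕ} (s : Fin n → ℤ × ℤ) (σ : ℤ × ℤ) {m : ℕ} (hm : m ≤ n) :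
    walkPosition (Fin.snoc s σ : Fin (n + 1) → ℤ × ℤ) m = walkPosition s m := by
  simp only [walkPosition, Finset.sum_filter]
  rw [Fin.sum_univ_castSucc]
  simp [Nat.not_lt.mpr hm]

theorem walkPosition_snoc_last {n : ℕ} (s : Fin n → ℤ × ℤ) (σ : ℤ × ℤ) :
    walkPosition (Fin.snoc s σ : Fin (n + 1) → ℤ × ℤ) (n + 1) = walkPosition s n + σ := by
  simp only [walkPosition, Finset.sum_filter]
  rw [Fin.sum_univ_castSucc]
  simp

theorem sum_quadrantWalks_succ (n : ℕ) (ψ : ℤ × ℤ → M) :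
    ∑ s ∈ quadrantWalks (n + 1), ψ (walkPosition s (n + 1)) =
      ∑ s ∈ quadrantWalks n, ∑ σ ∈ krewerasSteps with InQuadrant (walkPosition s n + σ),
        ψ (walkPosition s n + σ) := by
  rw [Finset.sum_sigma']
  symm
  refine Finset.sum_bij' (fun p _ => (Fin.snoc p.1 p.2 : Fin (n + 1) → ℤ × ℤ))
    (fun s _ => ⟨fun k => s k.castSucc, s (Fin.last n)⟩) ?_ ?_ ?_ ?_ ?_
  · rintro ⟨s, σ⟩ h
    simp only [quadrantWalks, Finset.mem_sigma, Finset.mem_filter, Fintype.mem_piFinset] at h ⊢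
    obtain ⟨⟨h1, h2⟩, h3, h4⟩ := h
    refine ⟨?_, ?_⟩
    · intro k
      refine Fin.lastCases ?_ (fun k => ?_) k
      · simpa using h3
      · simpa using h1 k
    · intro m hm
      rcases Nat.le_succ_iff.mp hm with hm | rfl
      · rw [walkPosition_snoc_of_le _ _ hm]
        exact h2 m hm
      · rw [Nat.succ_eq_add_one, walkPosition_snoc_last]
        exact h4
  · intro s h
    simp only [quadrantWalks, Finset.mem_sigma, Finset.mem_filter, Fintype.mem_piFinset] at h ⊢
    obtain ⟨h1, h2⟩ := h
    have hs : s = (Fin.snoc (fun k : Fin n => s k.castSucc) (s (Fin.last n)) :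
        Fin (n + 1) → ℤ × ℤ) := (Fin.snoc_init_self s).symm
    refine ⟨⟨fun k => h1 _, fun m hm => ?_⟩, h1 _, ?_⟩
    · have := h2 m (by omega)
      rwa [hs, walkPosition_snoc_of_le _ _ hm] at this
    · have := h2 (n + 1) le_rfl
      rwa [hs, walkPosition_snoc_last] at this
  · rintro ⟨s, σ⟩ h
    simp
  · intro s h
    exact Fin.snoc_init_self s
  · rintro ⟨s, σ⟩ h
    simp only [walkPosition_snoc_last]

theorem sum_krewerasSteps (φ : ℕ → ℕ → M) {p : ℤ × ℤ} (hp : InQuadrant p) :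
    (∑ σ ∈ krewerasSteps with InQuadrant (p + σ), φ (p + σ).1.toNat (p + σ).2.toNat) =
      stepSum φ p.1.toNat p.2.toNat := by
  obtain ⟨i, j⟩ := p
  obtain ⟨hi, hj⟩ := hp
  simp only at hi hj
  lift i to ℕ using hi
  lift j to ℕ using hj
  rw [Finset.sum_filter, krewerasSteps, Finset.sum_insert (by decide),
    Finset.sum_insert (by decide), Finset.sum_singleton, stepSum]
  have h1 : ((j : ℤ) + -1).toNat = j - 1 := by omega
  have h2 : ((i : ℤ) + -1).toNat = i - 1 := by omega
  have h3 : ((i : ℤ) + 1).toNat = i + 1 := by omega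
  have h4 : ((j : ℤ) + 1).toNat = j + 1 := by omega
  have h5 : InQuadrant ((i : ℤ), (j : ℤ) + -1) ↔ 1 ≤ j := by
    simp only [InQuadrant]; omega
  have h6 : InQuadrant ((i : ℤ) + -1, (j : ℤ)) ↔ 1 ≤ i := by
    simp only [InQuadrant]; omega
  have h7 : InQuadrant ((i : ℤ) + 1, (j : ℤ) + 1) := by
    simp only [InQuadrant]; omega
  simp only [Prod.mk_add_mk, h5, h6, if_pos h7, h1, h2, h3, h4, add_zero, Int.toNat_natCast]
  abel

/-- Bridge from step sequences to `walkSum`. Afterwards every functional equation is a pointwise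
identity between weights on the quadrant. `toNat` loses nothing, since end positions are
nonnegative. -/
theorem sum_quadrantWalks (n : ℕ) (φ : ℕ → ℕ → M) :
    ∑ s ∈ quadrantWalks n, φ (walkPosition s n).1.toNat (walkPosition s n).2.toNat =
      walkSum n φ := by
  induction n generalizing φ with
  | zero =>
    have : quadrantWalks 0 = Finset.univ := by
      ext s
      simp [quadrantWalks, InQuadrant, walkPosition]
    rw [this]
    simp [walkPosition, walkSum]
  | succ n ih =>
    rw [sum_quadrantWalks_succ n fun p => φ p.1.toNat p.2.toNat, walkSum, ← ih]
    refine Finset.sum_congr rfl fun s hs => sum_krewerasSteps φ ?_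
    exact (Finset.mem_filter.mp hs).2 n le_rfl

end Transfer

theorem krewerasDiagonal_eq :
    krewerasDiagonal = PowerSeries.mk fun n =>
      walkSum n fun i j => if i = j then (LaurentPolynomial.T 1 : ℚ[T;T⁻¹]) ^ j else 0 := by
  rw [krewerasDiagonal]
  congr 1
  funext n
  rw [← sum_quadrantWalks, ← Finset.sum_filter]
  have hle : ∀ s ∈ quadrantWalks n, (walkPosition s n).1.toNat < n + 1 := by
    intro s hs
    by_contra hlt
    rw [quadrantWalks, Finset.mem_filter] at hs
    have h := krewerasCount_eq_zero_of_lt (j := (walkPosition s n).2.toNat)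
      (i := (walkPosition s n).1.toNat) (n := n) (by omega)
    rw [krewerasCount, Finset.card_eq_zero] at h
    have : s ∈ krewerasWalks (walkPosition s n).1.toNat (walkPosition s n).2.toNat n := by
      rw [krewerasWalks, Finset.mem_filter]
      refine ⟨hs.1, hs.2, ?_⟩
      rw [Int.toNat_of_nonneg (hs.2 n le_rfl).1, Int.toNat_of_nonneg (hs.2 n le_rfl).2]
    simp [h] at this
  rw [← Finset.sum_fiberwise_of_maps_to (t := Finset.range (n + 1))
    (g := fun s => (walkPosition s n).1.toNat)
    (fun s hs => Finset.mem_range.mpr (hle s (Finset.mem_filter.mp hs).1))]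
  refine Finset.sum_congr rfl fun i _ => ?_
  have hset : ({s ∈ ({s ∈ quadrantWalks n | (walkPosition s n).1.toNat =
      (walkPosition s n).2.toNat} : Finset (Fin n → ℤ × ℤ)) | (walkPosition s n).1.toNat = i} :
      Finset _) = krewerasWalks i i n := by
    ext s
    simp only [quadrantWalks, krewerasWalks, Finset.mem_filter]
    constructor
    · rintro ⟨⟨⟨h1, h2⟩, h3⟩, h4⟩
      have : 0 ≤ (walkPosition s n).1 ∧ 0 ≤ (walkPosition s n).2 := h2 n le_rfl
      exact ⟨h1, h2, Prod.ext (by simp only; omega) (by simp only; omega)⟩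
    · rintro ⟨h1, h2, h3⟩
      refine ⟨⟨⟨h1, h2⟩, ?_⟩, ?_⟩ <;> simp [h3]
  rw [hset]
  have hc : ∀ s ∈ krewerasWalks i i n,
      (LaurentPolynomial.T 1 : ℚ[T;T⁻¹]) ^ (walkPosition s n).2.toNat = LaurentPolynomial.T i := by
    intro s hs
    rw [(Finset.mem_filter.mp hs).2.2]
    simp [LaurentPolynomial.T_pow]
  rw [Finset.sum_congr rfl hc, Finset.sum_const, nsmul_eq_mul, krewerasCount]

namespace PowerSeries

/-! ### Functional equations, kernel cancellation and the invariant. -/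

section Equations

variable {B : Type*} [CommRing B]

/-- The recursion for `Q(u, v)`, in terms of the polynomials that count walks by length. -/
theorem walkSum_monomial_succ (u v : B) (n : ℕ) :
    u * v * (walkSum (n + 1) fun i j => u ^ i * v ^ j) =
      (u + v + u ^ 2 * v ^ 2) * (walkSum n fun i j => u ^ i * v ^ j)
        - u * (walkSum n fun i j => if j = 0 then u ^ i else 0)
        - v * (walkSum n fun i j => if j = 0 then v ^ i else 0) := by
  -- Reflection turns this term into the walks with `i = 0`. The two subtracted terms are the
  -- forbidden South steps from `j = 0` and West steps from `i = 0`.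
  rw [← walkSum_swap n fun i j => if j = 0 then v ^ i else 0, walkSum]
  simp only [← walkSum_mul, ← walkSum_sub]
  congr 1
  funext i j
  rcases i with _ | i <;> rcases j with _ | j <;> simp [stepSum] <;> ring

/-- The diagonal is reached by North-East from itself, by South from `j = i + 1`, or by West from `i
= j + 1`; the last two contribute equally by symmetry. -/
theorem walkSum_diagonal_succ (z : B) (n : ℕ) :
    (walkSum (n + 1) fun i j => if i = j then z ^ j else 0) =
      z * (walkSum n fun i j => if i = j then z ^ j else 0)
        + 2 * walkSum n fun i j => if j = i + 1 then z ^ i else 0 := by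
  rw [two_mul, ← add_assoc]
  nth_rw 2 [← walkSum_swap n fun i j => if j = i + 1 then z ^ i else 0]
  rw [walkSum]
  simp only [← walkSum_mul, ← walkSum_add]
  congr 1
  funext i j
  have h1 : (1 ≤ i ∧ i - 1 = j) ↔ i = j + 1 := by omega
  have h2 : (1 ≤ j ∧ i = j - 1) ↔ j = i + 1 := by omega
  have h3 : (if 1 ≤ j then if i = j - 1 then z ^ (j - 1) else 0 else 0) =
      if j = i + 1 then z ^ i else 0 := by
    rw [← ite_and]
    by_cases h : j = i + 1
    · rw [if_pos (h2.mpr h), if_pos h, h, Nat.add_sub_cancel]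
    · rw [if_neg (h2.not.mpr h), if_neg h]
  simp only [stepSum, ← ite_and, h1] at h3 ⊢
  rw [h3]
  simp only [add_left_inj, pow_succ', mul_ite, mul_zero]
  ring

/-- In the coordinates `(i - j, j)` the steps have weights `u/z`, `1/u` and `z`. The corrections are
West steps leaving the diagonal, South steps entering it from `j = i + 1`, and South steps forbidden
on the axis. -/
theorem walkSum_halfplane_succ (u z : B) (n : ℕ) :
    z * u * (walkSum (n + 1) fun i j => if j ≤ i then u ^ (i - j) * z ^ j else 0) =
      (z ^ 2 * u + z + u ^ 2) * (walkSum n fun i j => if j ≤ i then u ^ (i - j) * z ^ j else 0)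
        - z * (walkSum n fun i j => if i = j then z ^ j else 0)
        + z * u * (walkSum n fun i j => if j = i + 1 then z ^ i else 0)
        - u ^ 2 * (walkSum n fun i j => if j = 0 then u ^ i else 0) := by
  rw [walkSum]
  simp only [← walkSum_mul, ← walkSum_sub, ← walkSum_add]
  congr 1
  funext i j
  simp only [stepSum]
  rcases lt_or_ge i j with hij | hij
  · obtain ⟨k, rfl⟩ := Nat.exists_eq_add_of_lt hij
    rcases k with _ | k
    · have h1 : ¬ i + 0 + 1 ≤ i - 1 := by omega
      have h2 : i + 0 + 1 - 1 = i := by omega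
      have h3 : ¬ i + 0 + 1 + 1 ≤ i + 1 := by omega
      have h4 : ¬ i + 0 + 1 ≤ i := by omega
      have h5 : ¬ i = i + 0 + 1 := by omega
      have h7 : ¬ i + 0 + 1 = 0 := by omega
      have h8 : 1 ≤ i + 0 + 1 := by omega
      simp only [h1, h2, h3, h4, h5, h7, h8, le_refl, if_true, if_false, ite_self, Nat.sub_self]
      ring
    · have h1 : ¬ i + (k + 1) + 1 ≤ i - 1 := by omega
      have h2 : ¬ i + (k + 1) + 1 - 1 ≤ i := by omega
      have h3 : ¬ i + (k + 1) + 1 + 1 ≤ i + 1 := by omega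
      have h4 : ¬ i + (k + 1) + 1 ≤ i := by omega
      have h5 : ¬ i = i + (k + 1) + 1 := by omega
      have h6 : ¬ i + (k + 1) + 1 = i + 1 := by omega
      have h7 : ¬ i + (k + 1) + 1 = 0 := by omega
      simp only [h1, h2, h3, h4, h5, h6, h7, if_false, ite_self]
      ring
  · obtain ⟨k, rfl⟩ := Nat.exists_eq_add_of_le hij
    have e1 : j + k + 1 - (j + 1) = k := by omega
    have e2 : j + k - j = k := by omega
    have e3 : ¬ j = j + k + 1 := by omega
    rw [e1, e2, if_neg e3, if_pos (show j + 1 ≤ j + k + 1 by omega),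
      if_pos (show j ≤ j + k by omega)]
    have e4 : (if 1 ≤ j + k then if j ≤ j + k - 1 then u ^ (j + k - 1 - j) * z ^ j else 0 else 0) * u
        = (u ^ k * z ^ j) - if j + k = j then z ^ j else 0 := by
      rcases k with _ | k
      · rcases j with _ | j
        · simp
        · simp
      · rw [if_pos (by omega), if_pos (by omega), if_neg (by omega),
          show j + (k + 1) - 1 - j = k by omega]
        ring
    have e5 : (if 1 ≤ j then if j - 1 ≤ j + k then u ^ (j + k - (j - 1)) * z ^ (j - 1) else 0 else 0)
        * z = u * (u ^ k * z ^ j) - u * if j = 0 then u ^ (j + k) else 0 := by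
      rcases j with _ | j
      · simp
      · rw [if_pos (by omega), if_pos (by omega), if_neg (by omega),
          show j + 1 + k - (j + 1 - 1) = k + 1 by omega, Nat.add_sub_cancel]
        ring
    linear_combination z * e4 + u * e5

/-- The generating function of walks ending on the `x`-axis, at `x = u`. -/
noncomputable def axisSeries (u : B⟦X⟧) : B⟦X⟧ :=
  diag (mk fun n => walkSum n fun i j => if j = 0 then u ^ i else 0)

theorem axisSeries_add_axisSeries {u v : B⟦X⟧} (h : u * v = X * (u + v + u ^ 2 * v ^ 2)) :
    X * u * axisSeries u + X * v * axisSeries v = u * v := by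
  have h1 : C (u * v) * (mk fun n => walkSum (n + 1) fun i j => u ^ i * v ^ j) =
      C (u + v + u ^ 2 * v ^ 2) * (mk fun n => walkSum n fun i j => u ^ i * v ^ j)
        - C u * (mk fun n => walkSum n fun i j => if j = 0 then u ^ i else 0)
        - C v * (mk fun n => walkSum n fun i j => if j = 0 then v ^ i else 0) := by
    ext1 n
    simpa only [map_sub, coeff_C_mul, coeff_mk] using walkSum_monomial_succ u v n
  have h2 := congrArg diag h1
  have h3 := diag_mk_eq fun n => walkSum n fun i j => u ^ i * v ^ j
  simp only [map_sub, map_mul, diag_C] at h2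
  simp only [walkSum.eq_1, pow_zero, mul_one] at h3
  simp only [axisSeries]
  linear_combination u * v * h3 + X * h2 -
    diag (mk fun n => walkSum n fun i j => u ^ i * v ^ j) * h

/-- The equation for the diagonal series obtained by the kernel method. -/
theorem diagonal_kernel_equation {z u w : B⟦X⟧} (hzw : z * w = 1)
    (hu : u = X * (1 + z * u + w * u ^ 2)) [IsDomain B] :
    (1 - X * z - 2 * X * w * u) *
        diag (mk fun n => walkSum n fun i j => if i = j then z ^ j else 0) =
      1 - 2 * w * (X * u * axisSeries u) := by
  set G := diag (mk fun n => walkSum n fun i j => if i = j then z ^ j else 0) with hG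
  have h1 : C (z * u) * (mk fun n => walkSum (n + 1) fun i j =>
      if j ≤ i then u ^ (i - j) * z ^ j else 0) =
      C (z ^ 2 * u + z + u ^ 2) * (mk fun n => walkSum n fun i j =>
          if j ≤ i then u ^ (i - j) * z ^ j else 0)
        - C z * (mk fun n => walkSum n fun i j => if i = j then z ^ j else 0)
        + C (z * u) * (mk fun n => walkSum n fun i j => if j = i + 1 then z ^ i else 0)
        - C (u ^ 2) * (mk fun n => walkSum n fun i j => if j = 0 then u ^ i else 0) := by
    ext1 n
    rw [map_sub, map_add, map_sub]
    simpa only [coeff_C_mul, coeff_mk] using walkSum_halfplane_succ u z n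
  have h2 : (mk fun n => walkSum (n + 1) fun i j => if i = j then z ^ j else 0) =
      C z * (mk fun n => walkSum n fun i j => if i = j then z ^ j else 0)
        + C 2 * (mk fun n => walkSum n fun i j => if j = i + 1 then z ^ i else 0) := by
    ext1 n
    simpa only [map_sub, map_add, coeff_C_mul, coeff_mk] using walkSum_diagonal_succ z n
  have h3 := congrArg diag h1
  have h4 := congrArg diag h2
  have h5 := diag_mk_eq fun n => walkSum n fun i j => if j ≤ i then u ^ (i - j) * z ^ j else 0
  have h6 := diag_mk_eq fun n => walkSum n fun i j => if i = j then z ^ j else 0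
  simp only [map_sub, map_add, map_mul, diag_C] at h3 h4
  simp only [walkSum.eq_1, pow_zero, mul_one, le_refl, if_true, Nat.sub_self] at h5 h6
  rw [← hG] at h3 h4 h6
  simp only [axisSeries]
  set F := diag (mk fun n => walkSum n fun i j => if j ≤ i then u ^ (i - j) * z ^ j else 0)
  set G₁ := diag (mk fun n => walkSum n fun i j => if j = i + 1 then z ^ i else 0)
  set q := diag (mk fun n => walkSum n fun i j => if j = 0 then u ^ i else 0)
  have hu0 : u ≠ 0 := by
    intro h0
    rw [h0] at hu
    simp [X_ne_zero.symm] at hu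
  have hz0 : z ≠ 0 := left_ne_zero_of_mul_eq_one hzw
  apply mul_left_cancel₀ (mul_ne_zero hz0 hu0)
  -- The equation for `u` is the vanishing of the kernel, so `F` drops out; the diagonal recursion
  -- eliminates `G₁`.
  linear_combination 2 * (z * u * h5 + X * h3 - z * F * hu - X * F * u ^ 2 * hzw)
    - z * u * (h6 + X * h4) + 2 * z * G * hu + 2 * X * u ^ 2 * q * hzw

/-- The kernel invariant of Kreweras walks. -/
noncomputable def krewerasInvariant (u q : B⟦X⟧) : B⟦X⟧ :=
  X ^ 2 * u ^ 2 * q ^ 2 - u * q + 2 * X * q + u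

/-- Put `a = tup`, `b = tvq`, so `a + b = uv` and `a² - b² = uv(a - b)`. In `tuv` times the
difference of the invariants, the kernel replaces `tu²v² - uv` by `-t(u + v)`; what remains is `t(v
- u)(a + b) + tuv(u - v) = 0`. -/
theorem krewerasInvariant_eq [IsDomain B] {u v p q : B⟦X⟧} (hu : u ≠ 0) (hv : v ≠ 0)
    (h : u * v = X * (u + v + u ^ 2 * v ^ 2)) (h' : X * u * p + X * v * q = u * v) :
    krewerasInvariant u p = krewerasInvariant v q := by
  apply mul_left_cancel₀ (mul_ne_zero X_ne_zero (mul_ne_zero hu hv))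
  simp only [krewerasInvariant]
  linear_combination
    (X * u * v * (X * u * p - X * v * q) + X * (v - u)) * h' - (X * u * p - X * v * q) * h

end Equations

end PowerSeries

namespace PowerSeries

/-! ### The invariant is constant in `x`, and its value. -/

section Evaluation

variable {B : Type*} [CommRing B] [Algebra ℚ B]

theorem substCoeff_axisSeries (u : B⟦X⟧) :
    substCoeff u (axisSeries (C Polynomial.X)) = axisSeries u := by
  have h : (axisSeries (C Polynomial.X) : (Polynomial ℚ)⟦X⟧) =
      mk fun n => walkSum n fun i j => if j = 0 then (Polynomial.X : Polynomial ℚ) ^ i else 0 := by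
    refine (congrArg diag ?_).trans (diag_map_C _)
    ext1 n
    rw [coeff_map, coeff_mk, coeff_mk]
    refine Eq.trans ?_ (walkSum_map (C (R := Polynomial ℚ)).toAddMonoidHom n _).symm
    congr 1
    funext i j
    simp [apply_ite (C (R := Polynomial ℚ))]
  rw [h, substCoeff, RingHom.comp_apply, axisSeries]
  congr 1
  ext1 n
  rw [coeff_map, coeff_mk, coeff_mk]
  refine (walkSum_map (Polynomial.aeval (R := ℚ) u).toRingHom.toAddMonoidHom n _).trans ?_
  congr 1
  funext i j
  simp [apply_ite (Polynomial.aeval (R := ℚ) u)]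

theorem substCoeff_krewerasInvariant (u : B⟦X⟧) :
    substCoeff u (krewerasInvariant (C Polynomial.X) (axisSeries (C Polynomial.X))) =
      krewerasInvariant u (axisSeries u) := by
  simp only [krewerasInvariant, map_add, map_sub, map_mul, map_pow, substCoeff_X, substCoeff_C_X,
    substCoeff_axisSeries, map_ofNat]

theorem exists_krewerasInvariant_eq_const :
    ∃ κ : ℚ⟦X⟧, krewerasInvariant (C Polynomial.X) (axisSeries (C Polynomial.X)) =
      map (Polynomial.C (R := ℚ)) κ := by
  set L : (Polynomial ℚ)⟦X⟧ := krewerasInvariant (C Polynomial.X) (axisSeries (C Polynomial.X))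
    with hL
  refine ⟨map (Polynomial.evalRingHom 0) L, ?_⟩
  set a : ℚ[T;T⁻¹] := LaurentPolynomial.T 1 with ha
  -- The kernel relation between `x` and `y`, divided by `x`: `y = t(1 + y/x + xy²)`.
  obtain ⟨y, hy⟩ := exists_eq_add_X_mul_eval (X : ℚ[T;T⁻¹]⟦X⟧)
    (Polynomial.C (C (LaurentPolynomial.T (-1))) * Polynomial.X
      + Polynomial.C (C a) * Polynomial.X ^ 2)
  simp only [Polynomial.eval_mul, Polynomial.eval_add, Polynomial.eval_C, Polynomial.eval_pow,
    Polynomial.eval_X] at hy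
  have hinv : (C a : ℚ[T;T⁻¹]⟦X⟧) * C (LaurentPolynomial.T (-1)) = 1 := by
    rw [← map_mul, ha, ← LaurentPolynomial.T_add]
    simp
  have hker : C a * y = X * (C a + y + C a ^ 2 * y ^ 2) := by
    linear_combination C a * hy + X * y * hinv
  have hinj : Function.Injective (Polynomial.aeval (R := ℚ) a) := by
    have : (Polynomial.aeval (R := ℚ) a) = Polynomial.toLaurentAlg := by
      ext
      simp [ha]
    rw [this]
    exact Polynomial.toLaurent_injective
  have hy0 : y ≠ 0 := by
    intro h0
    rw [h0] at hy
    simp [X_ne_zero.symm] at hy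
  have key := eq_zero_of_substCoeff_eq (D := L - map Polynomial.C (map (Polynomial.evalRingHom 0) L))
    hinj (y := y) (by rw [hy]; simp) (by ext1 n; simp) (by
      rw [map_sub, map_sub, substCoeff_map_C, substCoeff_map_C, hL, substCoeff_krewerasInvariant,
        substCoeff_krewerasInvariant,
        krewerasInvariant_eq (left_ne_zero_of_mul_eq_one hinv) hy0 hker
          (axisSeries_add_axisSeries hker)])
  exact sub_eq_zero.mp key

/-- The pair `u = v = W` satisfies the kernel relation, which forces `2tR(W) = W`; evaluating the
constant invariant at `W` gives `κ`. -/
theorem exists_krewerasInvariant_eq {W : ℚ⟦X⟧} (hW : W = X * (2 + W ^ 3)) :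
    ∃ κ : ℚ⟦X⟧, 4 * X * κ = X * W ^ 4 - 2 * W ^ 2 + 8 * X * W ∧
      ∀ u : B⟦X⟧, krewerasInvariant u (axisSeries u) = map (algebraMap ℚ B) κ := by
  obtain ⟨κ, hκ⟩ := exists_krewerasInvariant_eq_const
  refine ⟨κ, ?_, fun u => ?_⟩
  · have h1 := substCoeff_krewerasInvariant W
    rw [hκ, substCoeff_map_C, Algebra.algebraMap_self, map_id, id_eq] at h1
    have h2 := axisSeries_add_axisSeries (u := W) (v := W) (by linear_combination W * hW)
    have hW0 : W ≠ 0 := by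
      intro h0
      have : CharZero ℚ⟦X⟧ := algebraRat.charZero _
      rw [h0] at hW
      simp [X_ne_zero] at hW
    have h3 : 2 * X * axisSeries W = W := by
      apply mul_left_cancel₀ hW0
      linear_combination h2
    rw [h1, krewerasInvariant]
    linear_combination (X * W ^ 2 * (2 * X * axisSeries W + W) - 2 * W + 4 * X) * h3
  · rw [← substCoeff_krewerasInvariant, hκ, substCoeff_map_C]

end Evaluation

end PowerSeries

/-! ### The parameter `W` and the final computation. -/

open PowerSeries

theorem existsUnique_krewerasParameter : ∃! W : ℚ⟦X⟧, W = PowerSeries.X * (2 + W ^ 3) := by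
  obtain ⟨W, hW⟩ := exists_eq_add_X_mul_eval (0 : ℚ⟦X⟧) (2 + Polynomial.X ^ 3)
  simp only [Polynomial.eval_add, Polynomial.eval_pow, Polynomial.eval_X, zero_add,
    Polynomial.eval_ofNat] at hW
  refine ⟨W, hW, fun V hV => ?_⟩
  have h : (V - W) * (1 - PowerSeries.X * (V ^ 2 + V * W + W ^ 2)) = 0 := by
    linear_combination hV - hW
  rcases mul_eq_zero.mp h with h | h
  · exact sub_eq_zero.mp h
  · have := congrArg constantCoeff h
    simp at this

/-- There is a unique power series `W(t)` with `W = t (2 + W³)`; for it, the series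
`1 - x W (1 + W³/4) + x² W²/4` has a unique square root `S` with constant term `1` in `t`;
this `S` is invertible, and `t Q_d(x;t) = (W - 1/x) / S + 1/x`. -/
theorem mainTheorem6 :
    (∃! W : ℚ⟦X⟧, W = PowerSeries.X * (2 + W ^ 3)) ∧
    ∀ W : ℚ⟦X⟧, W = PowerSeries.X * (2 + W ^ 3) →
      ∃ S : (ℚ[T;T⁻¹]⟦X⟧)ˣ,
        (PowerSeries.constantCoeff (S : ℚ[T;T⁻¹]⟦X⟧) = 1 ∧
          (S : ℚ[T;T⁻¹]⟦X⟧) ^ 2 = diagonalRadicand W) ∧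
        (∀ S' : ℚ[T;T⁻¹]⟦X⟧, PowerSeries.constantCoeff S' = 1 → S' ^ 2 = diagonalRadicand W →
          S' = S) ∧
        PowerSeries.X * krewerasDiagonal =
          (liftSeries W - xPow (-1)) * ((S⁻¹ : (ℚ[T;T⁻¹]⟦X⟧)ˣ) : ℚ[T;T⁻¹]⟦X⟧) + xPow (-1) := by
  refine ⟨existsUnique_krewerasParameter, fun W hW => ?_⟩
  have : CharZero ℚ[T;T⁻¹] := algebraRat.charZero _
  set z : ℚ[T;T⁻¹]⟦X⟧ := xPow 1 with hz
  set w : ℚ[T;T⁻¹]⟦X⟧ := xPow (-1) with hw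
  set V : ℚ[T;T⁻¹]⟦X⟧ := liftSeries W with hV'
  set t : ℚ[T;T⁻¹]⟦X⟧ := PowerSeries.X with ht
  have hzw : z * w = 1 := by
    rw [hz, hw, xPow, xPow, ← map_mul, ← LaurentPolynomial.T_add]
    simp
  have hz2 : xPow 2 = z ^ 2 := by
    rw [hz, xPow, xPow, ← map_pow, LaurentPolynomial.T_pow]
    simp
  have hV : V = t * (2 + V ^ 3) := by
    have := congrArg liftSeries hW
    simp only [liftSeries, map_mul, map_add, map_pow, PowerSeries.map_X, map_ofNat] at this
    exact this
  have hrad : 4 * diagonalRadicand W = 4 - z * V * (4 + V ^ 3) + z ^ 2 * V ^ 2 := by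
    have h4 : (4 : ℚ[T;T⁻¹]⟦X⟧) * liftSeries (PowerSeries.C (1 / 4)) = 1 := by
      rw [liftSeries, ← map_ofNat (PowerSeries.map (algebraMap ℚ ℚ[T;T⁻¹])) 4,
        ← map_ofNat (PowerSeries.C (R := ℚ)) 4, ← map_mul, ← map_mul]
      norm_num
    rw [diagonalRadicand, hz2, ← hz]
    simp only [liftSeries, map_mul, map_add, map_pow, map_one] at h4 hV' ⊢
    rw [← hV']
    linear_combination (z ^ 2 * V ^ 2 - z * V ^ 4) * h4
  have hV0 : constantCoeff V = 0 := by rw [hV]; simp [ht]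
  obtain ⟨r, hr⟩ : t ∣ diagonalRadicand W - 1 := by
    have hVt : t ∣ V := ⟨_, hV⟩
    rw [ht, PowerSeries.X_dvd_iff] at hVt ⊢
    have h := congrArg constantCoeff hrad
    simp only [map_mul, map_add, map_sub, map_pow, hV0, map_ofNat] at h
    have h4 : (4 : ℚ[T;T⁻¹]) ≠ 0 := by norm_num
    apply mul_left_cancel₀ h4
    rw [map_sub, map_one]
    linear_combination h
  obtain ⟨s, hs0, hs⟩ := exists_sq_eq_one_add_X_mul r
  have hs2 : s ^ 2 = diagonalRadicand W := by rw [hs]; linear_combination -hr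
  have hsu : IsUnit s := by rw [PowerSeries.isUnit_iff_constantCoeff, hs0]; exact isUnit_one
  refine ⟨hsu.unit, ⟨hs0, hs2⟩, fun S' h0 h2 => ?_, ?_⟩
  · exact eq_of_sq_eq_sq_of_constantCoeff (h2.trans hs2.symm) (h0.trans hs0.symm) (by simp [h0])
  -- The kernel root of the half-plane equation: `u = t(1 + xu + u²/x)`.
  obtain ⟨u, hu⟩ := exists_eq_add_X_mul_eval t
    (Polynomial.C z * Polynomial.X + Polynomial.C w * Polynomial.X ^ 2)
  simp only [Polynomial.eval_mul, Polynomial.eval_add, Polynomial.eval_C, Polynomial.eval_pow,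
    Polynomial.eval_X, ← ht] at hu
  have hG := diagonal_kernel_equation hzw (u := u) (by linear_combination hu)
  have hG' : diag (PowerSeries.mk fun n => walkSum n fun i j => if i = j then z ^ j else 0) =
      krewerasDiagonal := by
    rw [krewerasDiagonal_eq]
    refine (congrArg diag ?_).trans (diag_map_C _)
    ext1 n
    rw [PowerSeries.coeff_map, PowerSeries.coeff_mk, PowerSeries.coeff_mk]
    refine Eq.trans ?_
      (walkSum_map (PowerSeries.C (R := ℚ[T;T⁻¹])).toAddMonoidHom n _).symm
    congr 1
    funext i j
    by_cases h : i = j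
    · simp only [h, if_true]
      exact (map_pow PowerSeries.C _ _).symm
    · simp [h]
  rw [hG', ← ht] at hG
  obtain ⟨κ, hκ, hinv⟩ := exists_krewerasInvariant_eq (B := ℚ[T;T⁻¹]) hW
  replace hκ := congrArg (PowerSeries.map (algebraMap ℚ ℚ[T;T⁻¹])) hκ
  specialize hinv u
  rw [krewerasInvariant, ← ht] at hinv
  simp only [map_mul, map_add, map_sub, map_pow, PowerSeries.map_X, map_ofNat, ← hinv] at hκ
  rw [← ht] at hκ
  change _ = t * V ^ 4 - 2 * V ^ 2 + 8 * t * V at hκ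
  set q := axisSeries u
  set θ := 1 - t * z - 2 * t * w * u with hθ
  -- Here `θ² ` is the discriminant of the kernel in `u`, and `m` completes the square in `I(u) =
  -- κ`. By `hG`, `m = (x t Q_d - 1)θ`.
  set m := -2 * t * (t * u * q) - 1 + 2 * t * z + 2 * t * w * u with hm
  have hθ2 : θ ^ 2 = (1 - t * z) ^ 2 - 4 * t ^ 2 * w := by
    rw [hθ]
    linear_combination -4 * t * w * hu
  have hm2 : m ^ 2 = 4 * t ^ 2 * z ^ 2 - 4 * t ^ 2 * w - 4 * t * z + 1
      + t * (t * V ^ 4 - 2 * V ^ 2 + 8 * t * V) := by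
    rw [hm, ← hκ]
    linear_combination (8 * t ^ 2 * q - 4 * t * w) * hu + 4 * t ^ 2 * u * hzw
  -- The squares agree modulo `V = t(2 + V³)`, and both sides have constant term `-1`, which settles
  -- the sign.
  have hms : m * s = (z * V - 1) * θ := by
    have ht0 : constantCoeff t = 0 := by simp [ht]
    refine eq_of_sq_eq_sq_of_constantCoeff ?_ ?_ ?_
    · have h4 : (4 : ℚ[T;T⁻¹]⟦X⟧) ≠ 0 := by
        intro h
        have h' := congrArg constantCoeff h
        rw [map_ofNat, map_zero] at h'
        revert h'
        norm_num
      apply mul_left_cancel₀ h4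
      rw [mul_pow, mul_pow, hθ2, hs2, hm2]
      linear_combination
        (4 * t ^ 2 * z ^ 2 - 4 * t ^ 2 * w - 4 * t * z + 1
          + t * (t * V ^ 4 - 2 * V ^ 2 + 8 * t * V)) * hrad
        - (8 * t * V + z * (-V ^ 2 * (10 + V ^ 3) * t - 4 + V ^ 3)
          + z ^ 2 * ((6 + V ^ 3) * t + 3 * V) - 4 * t * V * z ^ 3) * hV
        - 4 * t ^ 2 * (4 * V - V ^ 4 - 3 * z * V ^ 2) * hzw
    · simp [hm, hθ, hV0, ht0, hs0]
    · simp [hm, ht0, hs0]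
  have hθ0 : θ ≠ 0 := by
    intro h
    have := congrArg constantCoeff h
    simp [hθ, ht] at this
  have hfin : (t * krewerasDiagonal - w) * s = V - w := by
    apply mul_left_cancel₀ hθ0
    linear_combination t * s * hG + w * hms - w * s * hm - w * s * hθ + (θ * V - t * s) * hzw
  have hsi : s * ((hsu.unit⁻¹ : (ℚ[T;T⁻¹]⟦X⟧)ˣ) : ℚ[T;T⁻¹]⟦X⟧) = 1 := hsu.mul_val_inv
  linear_combination ((hsu.unit⁻¹ : (ℚ[T;T⁻¹]⟦X⟧)ˣ) : ℚ[T;T⁻¹]⟦X⟧) * hfin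
    - (t * krewerasDiagonal - w) * hsi
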